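/- Let $\mathbf{E}$ be a locally compact, complete, separable metric space, and let $\mathbf{N}_p$ be the space of Radon point measures on $\mathbf{E}$, that is, of measures $\xi=\sum_i\delta_{x_i}$ with a countable (possibly finite or empty) family of points $x_i\in\mathbf{E}$ such that $\xi(K)<\infty$ for every compact $K\subset\mathbf{E}$. Let $C_K^+(\mathbf{E})$ be the set of nonnegative continuous functions on $\mathbf{E}$ with compact support, and write $\xi(g)=\int g\,d\xi$. Equip $\mathbf{N}_p$ with the vague topology, the coarsest topology for which $\xi\mapsto\xi(g)$ is continuous for every $g\in C_K^+(\mathbf{E})$, and with its Borel $\sigma$-algebra. Let $\xi_0$ be the null measure. Let $\mathbf{M}_0(\mathbf{N}_p)$ be the set of Borel measures $m$ on $\mathbf{N}_p$ with $m(\mathbf{N}_p\setminus U)<\infty$ for every neighbourhood $U$ of $\xi_0$ (the mass of $\{\xi_0\}$ plays no role and is not restricted). Convergence $m_n\to m$ in $\mathbf{M}_0(\mathbf{N}_p)$ means that $\int f\,dm_n\to\int f\,dm$ for every bounded continuous $f:\mathbf{N}_p\to\mathbb{R}$ that vanishes in a neighbourhood of $\xi_0$. For $g_1,g_2\in C_K^+(\mathbf{E})$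 and $\varepsilon_1,\varepsilon_2>0$ put $$F_{g_1,g_2,\varepsilon_1,\varepsilon_2}(\xi)=\bigl(1-e^{-(\xi(g_1)-\varepsilon_1)_+}\bigr)\bigl(1-e^{-(\xi(g_2)-\varepsilon_2)_+}\bigr),\qquad \xi\in\mathbf{N}_p .$$ **Theorem.** Let $m,m_1,m_2,\dots\in\mathbf{M}_0(\mathbf{N}_p)$. Then $m_n\to m$ in $\mathbf{M}_0(\mathbf{N}_p)$ if and only if $$\lim_{n\to\infty}\int F_{g_1,g_2,\varepsilon_1,\varepsilon_2}\,dm_n=\int F_{g_1,g_2,\varepsilon_1,\varepsilon_2}\,dm$$ for all $g_1,g_2\in C_K^+(\mathbf{E})$ and all $\varepsilon_1,\varepsilon_2>0$. Moreover, if this limit relation holds for all Lipschitz functions $g_1,g_2\in C_K^+(\mathbf{E})$ and all $\varepsilon_1,\varepsilon_2>0$, then $m_n\to m$ in $\mathbf{M}_0(\mathbf{N}_p)$. -/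

import Mathlib

open Filter Topology MeasureTheory
open scoped NNReal ENNReal BoundedContinuousFunction CompactlySupported

/-- The space `N_p` of Radon point measures on `E`: measures of the form `∑ i, δ_{x i}`, where
`(x i)` is a countable (finite, possibly empty, or infinite) family of points of `E`, repetitions
allowed, which give finite mass to every compact set. -/
@[ext]
structure PointMeasure (E : Type*) [TopologicalSpace E] [MeasurableSpace E] where
  /-- The underlying measure on `E`. -/
  toMeasure : Measure E
  /-- It is a countable sum of unit point masses. -/
  isPoint : ∃ (I : Set ℕ) (x : I → E), toMeasure = Measure.sum fun i => Measure.dirac (x i)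
  /-- It is finite on compact sets. -/
  lt_top_of_isCompact : ∀ K : Set E, IsCompact K → toMeasure K < ∞

namespace PointMeasure

section Basic

variable {E : Type*} [TopologicalSpace E] [MeasurableSpace E]

/-- The null measure `ξ₀`. -/
instance : Zero (PointMeasure E) where
  zero :=
    { toMeasure := 0
      isPoint := ⟨∅, fun i => i.2.elim, by simp⟩
      lt_top_of_isCompact := fun K _ => by simp }

/-- `ξ(g) = ∫ g dξ` for `g ∈ C_K^+(E)`, a nonnegative continuous function of compact support. -/
noncomputable def eval (ξ : PointMeasure E) (g : C_c(E, ℝ≥0)) : ℝ :=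
  ∫ x, (g x : ℝ) ∂ξ.toMeasure

/-- The vague topology: the coarsest topology for which all maps `ξ ↦ ξ(g)`, `g ∈ C_K^+(E)`,
are continuous. -/
noncomputable instance : TopologicalSpace (PointMeasure E) :=
  ⨅ g : C_c(E, ℝ≥0), TopologicalSpace.induced (fun ξ => ξ.eval g) inferInstance

/-- The Borel σ-algebra of the vague topology. -/
noncomputable instance : MeasurableSpace (PointMeasure E) := borel _

instance : BorelSpace (PointMeasure E) := ⟨rfl⟩

/-- The functional `F_{g₁,g₂,ε₁,ε₂}(ξ) = (1 - e^{-(ξ(g₁)-ε₁)_+}) (1 - e^{-(ξ(g₂)-ε₂)_+})`. -/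
noncomputable def testF (g₁ g₂ : C_c(E, ℝ≥0)) (ε₁ ε₂ : ℝ) (ξ : PointMeasure E) : ℝ :=
  (1 - Real.exp (-(max (ξ.eval g₁ - ε₁) 0))) * (1 - Real.exp (-(max (ξ.eval g₂ - ε₂) 0)))

end Basic

end PointMeasure

/-- The space `M_0(N_p)`: Borel measures on `N_p` that are finite off every neighbourhood of the
null measure `ξ₀`. The mass of the single point `{ξ₀}` is not restricted, and no function that
is integrated below sees it: all of them vanish near `ξ₀`. The lemma
`PointMeasure.lt_top_compl_nhds_iff` expresses the finiteness condition through the balls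
of a metric for the vague topology. -/
structure MZero (E : Type*) [TopologicalSpace E] [MeasurableSpace E] where
  /-- The underlying Borel measure on `N_p`. -/
  toMeasure : Measure (PointMeasure E)
  /-- It is finite off every neighbourhood of the null measure. -/
  lt_top_compl : ∀ U ∈ 𝓝 (0 : PointMeasure E), toMeasure Uᶜ < ∞

namespace MZero

variable {E : Type*} [TopologicalSpace E] [MeasurableSpace E]

/-- Convergence `m_n → m` in `M_0(N_p)`: `m_n(f) → m(f)` for every bounded continuous function
`f` on `N_p` that vanishes in a neighbourhood of the null measure. -/
def Converges (mn : ℕ → MZero E) (m : MZero E) : Prop :=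
  ∀ f : PointMeasure E →ᵇ ℝ, (∀ᶠ ξ in 𝓝 (0 : PointMeasure E), f ξ = 0) →
    Tendsto (fun n => ∫ ξ, f ξ ∂(mn n).toMeasure) atTop (𝓝 (∫ ξ, f ξ ∂m.toMeasure))

end MZero

namespace PointMeasure

section Metric

variable {E : Type*} [TopologicalSpace E] [MeasurableSpace E]

/-- The sequence `(h i)` determines vague convergence in `N_p`. -/
def IsDetermining (h : ℕ → C_c(E, ℝ≥0)) : Prop :=
  ∀ (ξn : ℕ → PointMeasure E) (ξ : PointMeasure E),
    (∀ i, Tendsto (fun n => (ξn n).eval (h i)) atTop (𝓝 (ξ.eval (h i)))) →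
      Tendsto ξn atTop (𝓝 ξ)

/-- The distance on `N_p` given by a sequence `(h i)` in `C_K^+(E)`. -/
noncomputable def vagueDist (h : ℕ → C_c(E, ℝ≥0)) (ξ η : PointMeasure E) : ℝ :=
  ∑' i : ℕ, (1 / 2 : ℝ) ^ (i + 1) *
    (|ξ.eval (h i) - η.eval (h i)| / (1 + |ξ.eval (h i) - η.eval (h i)|))

theorem continuous_eval (g : C_c(E, ℝ≥0)) :
    Continuous fun ξ : PointMeasure E => ξ.eval g :=
  continuous_iInf_dom (i := g) continuous_induced_dom

theorem summable_bound : Summable fun i : ℕ => (1 / 2 : ℝ) ^ (i + 1) :=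
  (summable_nat_add_iff 1).2 (summable_geometric_of_lt_one (by norm_num) (by norm_num))

theorem frac_nonneg (t : ℝ) : 0 ≤ |t| / (1 + |t|) := by positivity

theorem frac_le_one (t : ℝ) : |t| / (1 + |t|) ≤ 1 :=
  div_le_one_of_le₀ (by linarith) (by positivity)

theorem norm_term_le (i : ℕ) (t : ℝ) :
    ‖(1 / 2 : ℝ) ^ (i + 1) * (|t| / (1 + |t|))‖ ≤ (1 / 2 : ℝ) ^ (i + 1) := by
  rw [Real.norm_of_nonneg (mul_nonneg (by positivity) (frac_nonneg t))]
  exact mul_le_of_le_one_right (by positivity) (frac_le_one t)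

theorem continuous_vagueDist (h : ℕ → C_c(E, ℝ≥0)) (η : PointMeasure E) :
    Continuous fun ξ : PointMeasure E => vagueDist h ξ η := by
  refine continuous_tsum (fun i => ?_) summable_bound (fun i ξ => norm_term_le i _)
  have hc : Continuous fun ξ : PointMeasure E => |ξ.eval (h i) - η.eval (h i)| :=
    ((continuous_eval (h i)).sub continuous_const).abs
  exact continuous_const.mul (hc.div (continuous_const.add hc) fun ξ => by positivity)

/-- If `(h i)` determines vague convergence, the balls of `vagueDist h` are a neighbourhood basis
of each point in the vague topology. -/
theorem nhds_hasBasis_vagueDist {h : ℕ → C_c(E, ℝ≥0)} (hh : IsDetermining h)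
    (η : PointMeasure E) :
    (𝓝 η).HasBasis (fun r : ℝ => 0 < r) fun r => {ξ | vagueDist h ξ η < r} := by
  refine ⟨fun U => ⟨fun hU => ?_, ?_⟩⟩
  · by_contra hcon
    push Not at hcon
    have hex : ∀ n : ℕ, ∃ ξ : PointMeasure E, vagueDist h ξ η < 1 / ((n : ℝ) + 1) ∧ ξ ∉ U := by
      intro n
      obtain ⟨ξ, h1, h2⟩ := Set.not_subset.1 (hcon (1 / ((n : ℝ) + 1)) (by positivity))
      exact ⟨ξ, h1, h2⟩
    choose ξ hξ hU' using hex
    have hlim : Tendsto ξ atTop (𝓝 η) := by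
      refine hh ξ η fun i => ?_
      rw [tendsto_iff_norm_sub_tendsto_zero]
      simp only [Real.norm_eq_abs]
      set a : ℕ → ℝ := fun n => |(ξ n).eval (h i) - η.eval (h i)| with ha
      have hterm : ∀ n, a n / (1 + a n) ≤ 2 ^ (i + 1) * (1 / ((n : ℝ) + 1)) := by
        intro n
        have hs : Summable fun j : ℕ => (1 / 2 : ℝ) ^ (j + 1) *
            (|(ξ n).eval (h j) - η.eval (h j)| / (1 + |(ξ n).eval (h j) - η.eval (h j)|)) :=
          Summable.of_norm_bounded summable_bound fun j => norm_term_le j _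
        have h1 := hs.le_tsum i fun j _ => mul_nonneg (by positivity) (frac_nonneg _)
        have h2 : (1 / 2 : ℝ) ^ (i + 1) * (a n / (1 + a n)) ≤ 1 / ((n : ℝ) + 1) :=
          h1.trans (hξ n).le
        calc a n / (1 + a n) = 2 ^ (i + 1) * ((1 / 2 : ℝ) ^ (i + 1) * (a n / (1 + a n))) := by
              rw [← mul_assoc, ← mul_pow]; norm_num
          _ ≤ _ := by gcongr
      have hb : Tendsto (fun n => a n / (1 + a n)) atTop (𝓝 0) := by
        refine squeeze_zero (fun n => frac_nonneg _) hterm ?_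
        simpa using (tendsto_one_div_add_atTop_nhds_zero_nat (𝕜 := ℝ)).const_mul
          ((2 : ℝ) ^ (i + 1))
      have hinv : ∀ n, a n = (a n / (1 + a n)) / (1 - a n / (1 + a n)) := by
        intro n
        have h0 : 0 ≤ a n := abs_nonneg _
        have h1 : (1 + a n) ≠ 0 := by positivity
        field_simp
        simp
      have hq : Tendsto (fun n => (a n / (1 + a n)) / (1 - a n / (1 + a n))) atTop
          (𝓝 (0 / (1 - 0))) :=
        hb.div (tendsto_const_nhds.sub hb) (by norm_num)
      simp only [zero_div] at hq
      exact hq.congr fun n => (hinv n).symm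
    obtain ⟨n, hn⟩ := (hlim.eventually hU).exists
    exact hU' n hn
  · rintro ⟨r, hr, hrU⟩
    refine mem_of_superset ?_ hrU
    refine (isOpen_lt (continuous_vagueDist h η) continuous_const).mem_nhds ?_
    simpa [vagueDist] using hr

/-- A measure on `N_p` is finite off every neighbourhood of the null measure if and only if it is
finite off every ball `{ξ | vagueDist h ξ ξ₀ < r}`, `r > 0`. -/
theorem lt_top_compl_nhds_iff {h : ℕ → C_c(E, ℝ≥0)} (hh : IsDetermining h)
    (m : Measure (PointMeasure E)) :
    (∀ U ∈ 𝓝 (0 : PointMeasure E), m Uᶜ < ∞) ↔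
      ∀ r : ℝ, 0 < r → m {ξ | vagueDist h ξ 0 < r}ᶜ < ∞ := by
  refine ⟨fun H r hr => H _ ((nhds_hasBasis_vagueDist hh 0).mem_of_mem hr), fun H U hU => ?_⟩
  obtain ⟨r, hr, hrU⟩ := (nhds_hasBasis_vagueDist hh 0).mem_iff.1 hU
  exact (measure_mono (Set.compl_subset_compl.2 hrU)).trans_lt (H r hr)

end Metric

end PointMeasure

/-! A function `f` that vanishes near the null measure vanishes on some `{ξ | ξ.eval h < δ}` with
`h` Lipschitz, so it is `cutoff h (δ / 2)` times a bounded continuous function. Convergence in `M_0`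
thus reduces to weak convergence of the finite measures with density `cutoff h (δ / 2)`. With `g₁ =
h`, the hypothesis says that these converge on every `cutoff g e`. Now `1 - cutoff g e` is uniformly
within `e` of `e^{-ξ(g)}`, and where the density is positive the constant 1 is a uniform limit of
functions `cutoff (k • h) 1`; hence masses and Laplace functionals converge
(`tendsto_laplace_weighted`).

Laplace functionals of Lipschitz functions determine weak convergence
(`tendsto_of_tendsto_laplace`): countably many Lipschitz `h i` induce the vague topology through `ξ
↦ (e^{-ξ(h i)})_i` into a compact cube, monomials in the coordinates are again of the form
`e^{-ξ(g)}`, and Stone–Weierstrass applies. No tightness argument is needed, since weak convergence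
pulls back along inducing maps.

The forward direction is immediate: each `testF` is itself an admissible test function. -/

/-! ### Weak convergence through an inducing map -/

section Weak

/-- Weak convergence of probability measures can be checked on the push-forwards under an
inducing map. -/
theorem ProbabilityMeasure.tendsto_of_tendsto_map_isInducing {Ω X : Type*}
    [TopologicalSpace Ω] [MeasurableSpace Ω] [BorelSpace Ω]
    [TopologicalSpace X] [MeasurableSpace X] [BorelSpace X] [HasOuterApproxClosed X]
    {Ψ : Ω → X} (hΨ : IsInducing Ψ) {μs : ℕ → ProbabilityMeasure Ω} {μ : ProbabilityMeasure Ω}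
    (h : Tendsto (fun n => (μs n).map hΨ.continuous.aemeasurable) atTop
      (𝓝 (μ.map hΨ.continuous.aemeasurable))) :
    Tendsto μs atTop (𝓝 μ) := by
  refine tendsto_of_forall_isOpen_le_liminf' fun G hG => ?_
  -- Every open set is a preimage of an open set, so the portmanteau inequality transfers; the range
  -- of `Ψ` need not be closed or measurable.
  obtain ⟨O, hO, rfl⟩ := hΨ.isOpen_iff.1 hG
  have := ProbabilityMeasure.le_liminf_measure_open_of_tendsto h hO
  simpa [ProbabilityMeasure.toMeasure_map, Measure.map_apply_of_aemeasurable
    hΨ.continuous.aemeasurable hO.measurableSet] using this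

/-- Convergence of integrals passes to functions that are uniform limits of test functions,
when the masses are bounded. -/
theorem tendsto_integral_of_approx {α : Type*} [MeasurableSpace α] {μs : ℕ → Measure α}
    {μ : Measure α} [∀ n, IsFiniteMeasure (μs n)] [IsFiniteMeasure μ] {M : ℝ}
    (hM : ∀ n, (μs n).real Set.univ ≤ M) {q : α → ℝ}
    (hq : ∀ n, Integrable q (μs n)) (hq' : Integrable q μ)
    (h : ∀ η > 0, ∃ p : α → ℝ, (∀ n, Integrable p (μs n)) ∧ Integrable p μ ∧
      (∀ n, ∀ᵐ x ∂μs n, |q x - p x| ≤ η) ∧ (∀ᵐ x ∂μ, |q x - p x| ≤ η) ∧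
      Tendsto (fun n => ∫ x, p x ∂μs n) atTop (𝓝 (∫ x, p x ∂μ))) :
    Tendsto (fun n => ∫ x, q x ∂μs n) atTop (𝓝 (∫ x, q x ∂μ)) := by
  have key : ∀ (ν : Measure α) [IsFiniteMeasure ν] (p : α → ℝ) (η : ℝ), Integrable q ν →
      Integrable p ν → (∀ᵐ x ∂ν, |q x - p x| ≤ η) →
      |∫ x, q x ∂ν - ∫ x, p x ∂ν| ≤ η * ν.real Set.univ := by
    intro ν _ p η h1 h2 h3
    rw [← integral_sub h1 h2]
    simp only [← Real.norm_eq_abs] at h3 ⊢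
    exact norm_integral_le_of_norm_le_const h3
  have hM0 : 0 ≤ M := measureReal_nonneg.trans (hM 0)
  set C := M + μ.real Set.univ + 1 with hC
  have hμ0 : 0 ≤ μ.real Set.univ := measureReal_nonneg
  have hC0 : 0 < C := by positivity
  rw [Metric.tendsto_atTop]
  intro r hr
  obtain ⟨p, hp1, hp2, hp3, hp4, hp5⟩ := h (r / (3 * C)) (by positivity)
  obtain ⟨N, hN⟩ := Metric.tendsto_atTop.1 hp5 (r / 3) (by positivity)
  refine ⟨N, fun n hn => ?_⟩
  have h1 := key (μs n) p _ (hq n) (hp1 n) (hp3 n)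
  have h2 := key μ p _ hq' hp2 hp4
  have h3 := hN n hn
  rw [Real.dist_eq] at h3 ⊢
  have hb : ∀ t, t ≤ C → r / (3 * C) * t ≤ r / 3 := by
    intro t ht
    calc r / (3 * C) * t ≤ r / (3 * C) * C := by gcongr
      _ = r / 3 := by field_simp
  have h1' := h1.trans (hb _ (by linarith [hM n]))
  have h2' := h2.trans (hb _ (by linarith))
  rw [abs_le] at h1' h2'
  rw [abs_lt] at h3 ⊢
  constructor <;> linarith

/-- By Stone–Weierstrass `A` is uniformly dense in `C(X, ℝ)`, so the normalized push-forwards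
converge weakly. The masses converge because `1 ∈ A`. -/
theorem FiniteMeasure.tendsto_of_subalgebra_of_isInducing {Ω X : Type*}
    [TopologicalSpace Ω] [MeasurableSpace Ω] [BorelSpace Ω]
    [TopologicalSpace X] [CompactSpace X] [MeasurableSpace X] [BorelSpace X]
    [HasOuterApproxClosed X]
    {Ψ : Ω → X} (hΨ : IsInducing Ψ) {A : Subalgebra ℝ C(X, ℝ)} (hA : A.SeparatesPoints)
    {μs : ℕ → FiniteMeasure Ω} {μ : FiniteMeasure Ω}
    (h : ∀ p ∈ A, Tendsto (fun n => ∫ ω, p (Ψ ω) ∂(μs n : Measure Ω)) atTop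
      (𝓝 (∫ ω, p (Ψ ω) ∂(μ : Measure Ω)))) :
    Tendsto μs atTop (𝓝 μ) := by
  have hmass : Tendsto (fun n => (μs n).mass) atTop (𝓝 μ.mass) := by
    have := h 1 A.one_mem
    simp only [ContinuousMap.one_apply, integral_const, smul_eq_mul, mul_one] at this
    exact NNReal.tendsto_coe.1 this
  by_cases hμ : μ = 0
  · subst hμ
    exact FiniteMeasure.tendsto_zero_of_tendsto_zero_mass (by simpa using hmass)
  -- `normalize` needs a point of `Ω` for its default value at the zero measure.
  have : Nonempty Ω := by
    by_contra hne
    rw [not_nonempty_iff] at hne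
    exact hμ (Subtype.ext (Measure.eq_zero_of_isEmpty _))
  have hm0 : μ.mass ≠ 0 := μ.mass_nonzero_iff.2 hμ
  have hint : ∀ (ν : FiniteMeasure Ω), ν.mass ≠ 0 → ∀ p : Ω → ℝ,
      ∫ ω, p ω ∂(ν.normalize : Measure Ω) = (ν.mass : ℝ)⁻¹ * ∫ ω, p ω ∂(ν : Measure Ω) := by
    intro ν hν p
    rw [ν.toMeasure_normalize_eq_of_nonzero (ν.mass_nonzero_iff.1 hν)]
    rw [integral_smul_nnreal_measure]
    simp [NNReal.smul_def]
  refine (FiniteMeasure.tendsto_normalize_iff_tendsto hμ).1 ⟨?_, hmass⟩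
  refine ProbabilityMeasure.tendsto_of_tendsto_map_isInducing hΨ ?_
  rw [ProbabilityMeasure.tendsto_iff_forall_integral_tendsto]
  intro q
  have hmp : ∀ ν : ProbabilityMeasure Ω, ∀ p : C(X, ℝ),
      ∫ x, p x ∂(ν.map hΨ.continuous.aemeasurable : ProbabilityMeasure X)
        = ∫ ω, p (Ψ ω) ∂(ν : Measure Ω) := by
    intro ν p
    rw [ProbabilityMeasure.toMeasure_map, integral_map hΨ.continuous.aemeasurable
      p.continuous.aestronglyMeasurable]
  have hI : ∀ (ν : ProbabilityMeasure X) (p : C(X, ℝ)), Integrable p (ν : Measure X) := by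
    intro ν p
    exact (BoundedContinuousFunction.mkOfCompact p).integrable _
  refine tendsto_integral_of_approx (M := 1) (fun n => by simp) (fun n => q.integrable _)
    (q.integrable _) fun η hη => ?_
  have hq : q.toContinuousMap ∈ A.topologicalClosure := by
    rw [ContinuousMap.subalgebra_topologicalClosure_eq_top_of_separatesPoints A hA]
    trivial
  obtain ⟨p, hpA, hp⟩ := Metric.mem_closure_iff.1
    ((Subalgebra.topologicalClosure_coe A) ▸ hq : q.toContinuousMap ∈ closure (A : Set C(X, ℝ))) η hη
  have hpq : ∀ x, |q x - p x| ≤ η := fun x =>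
    (ContinuousMap.dist_apply_le_dist (f := q.toContinuousMap) (g := p) x).trans hp.le
  refine ⟨p, fun n => hI _ p, hI _ p, fun n => .of_forall hpq, .of_forall hpq, ?_⟩
  simp only [hmp]
  rw [hint μ hm0]
  have hev : ∀ᶠ n in atTop, (μs n).mass ≠ 0 := hmass.eventually_ne hm0
  refine Tendsto.congr' (hev.mono fun n hn => (hint (μs n) hn _).symm) ?_
  exact ((NNReal.tendsto_coe.2 hmass).inv₀ (by exact_mod_cast hm0)).mul (h p hpA)

end Weak

/-! ### Lipschitz approximation in `C_K^+(E)` -/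

section Lipschitz

variable {E : Type*} [MetricSpace E]

/-- A nonnegative continuous function of compact support is a uniform limit from below of
Lipschitz functions. -/
theorem exists_lipschitz_le_approx (g : C_c(E, ℝ≥0)) {ε : ℝ} (hε : 0 < ε) :
    ∃ h : C(E, ℝ≥0), (∃ K : ℝ≥0, LipschitzWith K h) ∧ (∀ x, h x ≤ g x) ∧
      ∀ x, (g x : ℝ) ≤ h x + ε := by
  have huc : UniformContinuous g := g.hasCompactSupport.uniformContinuous_of_continuous g.continuous
  obtain ⟨δ, hδ, huc⟩ := Metric.uniformContinuous_iff.1 huc ε hε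
  obtain ⟨M, hM⟩ : ∃ M : ℝ≥0, ∀ x, g x ≤ M := by
    obtain ⟨M, hM⟩ := (g.hasCompactSupport.isCompact_range g.continuous).bddAbove
    exact ⟨M, fun x => hM ⟨x, rfl⟩⟩
  -- With this slope the penalty `L * dist x y` is at least `sup g` once `dist x y ≥ δ`, so only
  -- points within `δ` matter below.
  set L : ℝ≥0 := M / δ.toNNReal with hL
  have hLδ : (L : ℝ) * δ = M := by
    simp only [hL, NNReal.coe_div, Real.coe_toNNReal _ hδ.le]
    field_simp
  -- The inf-convolution: the largest `L`-Lipschitz minorant of `g`.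
  set k : E → ℝ := fun x => ⨅ y : E, ((g y : ℝ) + L * dist x y) with hk
  have hbdd : ∀ x, BddBelow (Set.range fun y : E => ((g y : ℝ) + L * dist x y)) := fun x =>
    ⟨0, by rintro _ ⟨y, rfl⟩; positivity⟩
  have hk0 : ∀ x, 0 ≤ k x := fun x => Real.iInf_nonneg fun y => by positivity
  have hkg : ∀ x, k x ≤ g x := fun x => (ciInf_le (hbdd x) x).trans (by simp)
  have hlip : LipschitzWith L k := by
    refine LipschitzWith.of_le_add_mul L fun x y => ?_
    have : Nonempty E := ⟨x⟩
    rw [← sub_le_iff_le_add]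
    refine le_ciInf fun z => ?_
    rw [sub_le_iff_le_add]
    calc k x ≤ g z + L * dist x z := ciInf_le (hbdd x) z
      _ ≤ g z + L * (dist x y + dist y z) := by gcongr; exact dist_triangle _ _ _
      _ = _ := by ring
  have hkl : ∀ x, (g x : ℝ) ≤ k x + ε := by
    intro x
    have : Nonempty E := ⟨x⟩
    rw [← sub_le_iff_le_add]
    refine le_ciInf fun y => ?_
    rcases lt_or_ge (dist x y) δ with hxy | hxy
    · have h1 := huc hxy
      rw [NNReal.dist_eq] at h1
      have h2 : 0 ≤ (L : ℝ) * dist x y := by positivity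
      linarith [(abs_lt.1 h1).2]
    · have h1 : (g x : ℝ) ≤ M := hM x
      have h2 : (L : ℝ) * δ ≤ L * dist x y := by gcongr
      have h3 : (0 : ℝ) ≤ g y := (g y).2
      linarith
  have hlip' : LipschitzWith L fun x => (⟨k x, hk0 x⟩ : ℝ≥0) :=
    LipschitzWith.of_dist_le_mul fun x y => hlip.dist_le_mul x y
  exact ⟨⟨_, hlip'.continuous⟩, ⟨L, hlip'⟩, hkg, hkl⟩

/-- A compact set has a Lipschitz bump function of compact support. -/
theorem IsCompact.exists_lipschitz_bump [LocallyCompactSpace E] {K : Set E} (hK : IsCompact K) :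
    ∃ χ : C_c(E, ℝ≥0), (∃ L : ℝ≥0, LipschitzWith L χ) ∧ ∀ x ∈ K, χ x = 1 := by
  obtain ⟨δ, hδ, hc⟩ := hK.exists_isCompact_cthickening
  have hsupp : HasCompactSupport (thickenedIndicator hδ K) := by
    refine HasCompactSupport.intro hc fun x hx => thickenedIndicator_zero hδ K fun h => ?_
    exact hx (Metric.thickening_subset_cthickening _ _ h)
  exact ⟨⟨(thickenedIndicator hδ K).toContinuousMap, hsupp⟩,
    ⟨_, lipschitzWith_thickenedIndicator hδ K⟩, fun x hx => thickenedIndicator_one hδ K hx⟩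

/-- There is a sequence of Lipschitz functions in `C_K^+(E)` that approximates every function
in `C_K^+(E)`, uniformly relative to a member of the sequence. -/
theorem exists_seq_lipschitz_approx [TopologicalSpace.SeparableSpace E] [LocallyCompactSpace E] :
    ∃ h : ℕ → C_c(E, ℝ≥0), (∀ i, ∃ K : ℝ≥0, LipschitzWith K (h i)) ∧
      ∀ g : C_c(E, ℝ≥0), ∃ j, ∀ ε : ℝ, 0 < ε →
        ∃ i, ∀ x, |(g x : ℝ) - h i x| ≤ ε * h j x := by
  have : SecondCountableTopology E := UniformSpace.secondCountable_of_separable E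
  let Kn : CompactExhaustion E := CompactExhaustion.choice E
  choose χ hχL hχ1 using fun n => (Kn.isCompact n).exists_lipschitz_bump
  -- In `S n` the compact-open topology is that of uniform convergence, since all members vanish off
  -- `Kn n`; second countability supplies a dense sequence.
  let S : ℕ → Set C(E, ℝ≥0) := fun n =>
    {f | (∃ K : ℝ≥0, LipschitzWith K f) ∧ ∀ x ∉ Kn n, f x = 0}
  have hex : ∀ n, ∃ D : Set (S n), D.Countable ∧ Dense D := fun n =>
    TopologicalSpace.exists_countable_dense (S n)
  choose D hDc hDd using hex
  have hcs : ∀ n (f : S n), HasCompactSupport f.1 := fun n f =>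
    HasCompactSupport.intro (Kn.isCompact n) f.2.2
  let F : Set C_c(E, ℝ≥0) := Set.range χ ∪ ⋃ n, (fun f : S n => ⟨f.1, hcs n f⟩) '' D n
  have hFc : F.Countable :=
    (Set.countable_range χ).union (Set.countable_iUnion fun n => (hDc n).image _)
  obtain ⟨h, hh⟩ := hFc.exists_eq_range ⟨χ 0, Or.inl ⟨0, rfl⟩⟩
  refine ⟨h, fun i => ?_, fun g => ?_⟩
  · have : h i ∈ F := hh ▸ ⟨i, rfl⟩
    rcases this with ⟨n, hn⟩ | hi
    · exact hn ▸ hχL n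
    · obtain ⟨n, f, -, hf⟩ := Set.mem_iUnion.1 hi
      rw [← hf]
      exact f.2.1
  · obtain ⟨n, hn⟩ := Kn.exists_superset_of_isCompact g.hasCompactSupport
    have h2 : χ n ∈ F := Or.inl ⟨n, rfl⟩
    rw [hh] at h2
    obtain ⟨j, hj⟩ := h2
    refine ⟨j, fun ε hε => ?_⟩
    -- Approximation from below makes `k` vanish wherever `g` does, so `k` lies in `S n`.
    obtain ⟨k, hkL, hkg, hgk⟩ := exists_lipschitz_le_approx g (half_pos hε)
    have hg0 : ∀ x ∉ Kn n, g x = 0 := fun x hx => image_eq_zero_of_notMem_tsupport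
      fun hx' => hx (hn hx')
    have hk0 : ∀ x ∉ Kn n, k x = 0 := fun x hx =>
      le_antisymm ((hkg x).trans (hg0 x hx).le) zero_le
    let k' : S n := ⟨k, hkL, hk0⟩
    have hev : ∀ᶠ f : C(E, ℝ≥0) in 𝓝 k, ∀ x ∈ Kn n, dist (k x) (f x) < ε / 2 :=
      Metric.tendstoUniformlyOn_iff.1
        (ContinuousMap.tendsto_iff_forall_isCompact_tendstoUniformlyOn.1
          (tendsto_id (x := 𝓝 k)) (Kn n) (Kn.isCompact n)) (ε / 2) (half_pos hε)
    have hev' : ∀ᶠ f : S n in 𝓝 k', ∀ x ∈ Kn n, dist (k x) (f.1 x) < ε / 2 :=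
      (continuous_subtype_val.tendsto k').eventually hev
    obtain ⟨f, hfD, hf⟩ := (hDd n).inter_nhds_nonempty hev'
    have h1 : (⟨f.1, hcs n f⟩ : C_c(E, ℝ≥0)) ∈ F :=
      Or.inr (Set.mem_iUnion.2 ⟨n, f, hfD, rfl⟩)
    rw [hh] at h1
    obtain ⟨i, hi⟩ := h1
    refine ⟨i, fun x => ?_⟩
    rw [hi, hj]
    change |(g x : ℝ) - f.1 x| ≤ _
    by_cases hx : x ∈ Kn n
    · rw [hχ1 n x hx]
      have a1 := hf x hx
      rw [NNReal.dist_eq, abs_lt] at a1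
      have a2 : (k x : ℝ) ≤ g x := hkg x
      have a3 := hgk x
      rw [NNReal.coe_one, mul_one, abs_le]
      constructor <;> linarith
    · rw [hg0 x hx, f.2.2 x hx]
      simp only [sub_self, abs_zero]
      positivity

end Lipschitz

/-! ### Evaluations and the embedding into the cube -/

namespace PointMeasure

section Eval

variable {E : Type*} [TopologicalSpace E] [MeasurableSpace E]

theorem eval_nonneg (ξ : PointMeasure E) (g : C_c(E, ℝ≥0)) : 0 ≤ ξ.eval g :=
  integral_nonneg fun x => (g x).2

theorem zero_eval (g : C_c(E, ℝ≥0)) : (0 : PointMeasure E).eval g = 0 :=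
  integral_zero_measure _

theorem eval_zero (ξ : PointMeasure E) : ξ.eval (0 : C_c(E, ℝ≥0)) = 0 := by
  simp [eval]

theorem eval_smul (ξ : PointMeasure E) (c : ℝ≥0) (g : C_c(E, ℝ≥0)) :
    ξ.eval (c • g) = c * ξ.eval g := by
  simp [eval, integral_const_mul]

variable [OpensMeasurableSpace E]

theorem integrable_coe (ξ : PointMeasure E) (g : C_c(E, ℝ≥0)) :
    Integrable (fun x => (g x : ℝ)) ξ.toMeasure := by
  have : IsFiniteMeasureOnCompacts ξ.toMeasure := ⟨fun K hK => ξ.lt_top_of_isCompact K hK⟩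
  refine Continuous.integrable_of_hasCompactSupport (NNReal.continuous_coe.comp g.continuous) ?_
  exact g.hasCompactSupport.comp_left NNReal.coe_zero

theorem eval_add (ξ : PointMeasure E) (g₁ g₂ : C_c(E, ℝ≥0)) :
    ξ.eval (g₁ + g₂) = ξ.eval g₁ + ξ.eval g₂ := by
  simp only [eval, CompactlySupportedContinuousMap.add_apply, NNReal.coe_add]
  exact integral_add (ξ.integrable_coe g₁) (ξ.integrable_coe g₂)

theorem eval_mono (ξ : PointMeasure E) {g₁ g₂ : C_c(E, ℝ≥0)} (h : ∀ x, g₁ x ≤ g₂ x) :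
    ξ.eval g₁ ≤ ξ.eval g₂ :=
  integral_mono (ξ.integrable_coe g₁) (ξ.integrable_coe g₂) h

theorem abs_eval_sub_le (ξ : PointMeasure E) {g h k : C_c(E, ℝ≥0)} {ε : ℝ}
    (hghk : ∀ x, |(g x : ℝ) - h x| ≤ ε * k x) : |ξ.eval g - ξ.eval h| ≤ ε * ξ.eval k := by
  simp only [eval]
  rw [← integral_sub (ξ.integrable_coe g) (ξ.integrable_coe h), ← integral_const_mul]
  exact (abs_integral_le_integral_abs).trans (integral_mono
    ((ξ.integrable_coe g).sub (ξ.integrable_coe h)).abs ((ξ.integrable_coe k).const_mul ε) hghk)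

end Eval

section Embedding

variable {E : Type*} [TopologicalSpace E] [MeasurableSpace E]

theorem nhds_eq_iInf_comap_eval (ξ : PointMeasure E) :
    𝓝 ξ = ⨅ g : C_c(E, ℝ≥0), comap (fun η : PointMeasure E => η.eval g) (𝓝 (ξ.eval g)) := by
  refine nhds_iInf.trans ?_
  simp only [nhds_induced]

/-- The map `ξ ↦ (e^{-ξ(h i)})_i` into the cube. -/
noncomputable def toCube (h : ℕ → C_c(E, ℝ≥0)) (ξ : PointMeasure E) : ℕ → unitInterval :=
  fun i => ⟨Real.exp (-ξ.eval (h i)), (Real.exp_pos _).le,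
    Real.exp_le_one_iff.2 (neg_nonpos.2 (ξ.eval_nonneg _))⟩

/-- Taking logarithms, closeness in the cube controls each `η(h i)`. Total masses may be unbounded,
so `η(g) - η(h i)` is controlled through `η(h j)`, which stays bounded near `ξ`. -/
theorem isInducing_toCube [OpensMeasurableSpace E] {h : ℕ → C_c(E, ℝ≥0)}
    (hh : ∀ g : C_c(E, ℝ≥0), ∃ j, ∀ ε : ℝ, 0 < ε →
      ∃ i, ∀ x, |(g x : ℝ) - h i x| ≤ ε * h j x) :
    IsInducing (toCube h) := by
  have hcont : Continuous (toCube h) := continuous_pi fun i =>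
    Continuous.subtype_mk (Real.continuous_exp.comp (continuous_eval (h i)).neg) _
  rw [isInducing_iff_nhds]
  intro ξ
  refine le_antisymm (hcont.tendsto ξ).le_comap ?_
  rw [nhds_eq_iInf_comap_eval]
  refine le_iInf fun g => ?_
  rw [← tendsto_iff_comap]
  set l := comap (toCube h) (𝓝 (toCube h ξ)) with hl
  have hi : ∀ i, Tendsto (fun η : PointMeasure E => η.eval (h i)) l (𝓝 (ξ.eval (h i))) := by
    intro i
    have h1 : Tendsto (fun η : PointMeasure E => ((toCube h η i : unitInterval) : ℝ)) l
        (𝓝 ((toCube h ξ i : unitInterval) : ℝ)) :=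
      ((continuous_subtype_val.comp (continuous_apply i)).tendsto (toCube h ξ)).comp
        tendsto_comap
    have h2 := (h1.log (Real.exp_pos _).ne').neg
    simpa [toCube] using h2
  rw [Metric.tendsto_nhds]
  intro ε hε
  obtain ⟨j, hj⟩ := hh g
  set C := ξ.eval (h j) with hC
  have hC0 : 0 ≤ C := ξ.eval_nonneg _
  obtain ⟨i, hij⟩ := hj (ε / (4 * (C + 1))) (by positivity)
  filter_upwards [(hi j).eventually_lt_const (lt_add_one C),
    Metric.tendsto_nhds.1 (hi i) (ε / 4) (by positivity)] with η h1 h2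
  have hb : ∀ t, t ≤ C + 1 → ε / (4 * (C + 1)) * t ≤ ε / 4 := by
    intro t ht
    calc ε / (4 * (C + 1)) * t ≤ ε / (4 * (C + 1)) * (C + 1) := by gcongr
      _ = ε / 4 := by field_simp
  have h3 := (η.abs_eval_sub_le hij).trans (hb _ h1.le)
  have h4 := (ξ.abs_eval_sub_le hij).trans (hb _ (by linarith))
  rw [Real.dist_eq] at h2 ⊢
  rw [abs_le] at h3 h4
  rw [abs_lt] at h2 ⊢
  constructor <;> linarith

end Embedding

end PointMeasure

/-! ### Closure properties of Lipschitz functions -/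

section LipschitzAlgebra

variable {E : Type*} [MetricSpace E]

theorem exists_lipschitzWith_add {f g : C_c(E, ℝ≥0)} (hf : ∃ K : ℝ≥0, LipschitzWith K f)
    (hg : ∃ K : ℝ≥0, LipschitzWith K g) : ∃ K : ℝ≥0, LipschitzWith K (f + g) := by
  obtain ⟨K, hK⟩ := hf
  obtain ⟨L, hL⟩ := hg
  refine ⟨K + L, LipschitzWith.of_dist_le_mul fun x y => ?_⟩
  have h1 := hK.dist_le_mul x y
  have h2 := hL.dist_le_mul x y
  rw [NNReal.dist_eq] at h1 h2 ⊢
  simp only [CompactlySupportedContinuousMap.add_apply, NNReal.coe_add]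
  rw [abs_le] at h1 h2 ⊢
  constructor <;> linarith

theorem exists_lipschitzWith_smul (c : ℝ≥0) {f : C_c(E, ℝ≥0)}
    (hf : ∃ K : ℝ≥0, LipschitzWith K f) : ∃ K : ℝ≥0, LipschitzWith K (c • f) := by
  obtain ⟨K, hK⟩ := hf
  refine ⟨c * K, LipschitzWith.of_dist_le_mul fun x y => ?_⟩
  have h1 := hK.dist_le_mul x y
  rw [NNReal.dist_eq] at h1 ⊢
  simp only [CompactlySupportedContinuousMap.smul_apply, smul_eq_mul, NNReal.coe_mul]
  rw [← mul_sub, abs_mul, NNReal.abs_eq, mul_assoc]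
  gcongr

theorem exists_lipschitzWith_zero : ∃ K : ℝ≥0, LipschitzWith K (0 : C_c(E, ℝ≥0)) :=
  ⟨0, LipschitzWith.const 0⟩

end LipschitzAlgebra

/-! ### Laplace functionals and neighbourhoods of the null measure -/

namespace PointMeasure

variable {E : Type*} [MetricSpace E] [LocallyCompactSpace E]
  [MeasurableSpace E] [BorelSpace E]

/-- Convergence of the Laplace functionals on Lipschitz functions implies weak convergence of
finite measures on `N_p`. -/
theorem tendsto_of_tendsto_laplace [TopologicalSpace.SeparableSpace E]
    {μs : ℕ → FiniteMeasure (PointMeasure E)}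
    {μ : FiniteMeasure (PointMeasure E)}
    (H : ∀ g : C_c(E, ℝ≥0), (∃ K : ℝ≥0, LipschitzWith K g) →
      Tendsto (fun n => ∫ ξ, Real.exp (-ξ.eval g) ∂(μs n : Measure (PointMeasure E))) atTop
        (𝓝 (∫ ξ, Real.exp (-ξ.eval g) ∂(μ : Measure (PointMeasure E))))) :
    Tendsto μs atTop (𝓝 μ) := by
  obtain ⟨h, hL, hh⟩ := exists_seq_lipschitz_approx (E := E)
  have hΨ := isInducing_toCube hh
  let proj : ℕ → C(ℕ → unitInterval, ℝ) := fun i =>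
    ⟨fun y => (y i : ℝ), continuous_subtype_val.comp (continuous_apply i)⟩
  let A : Subalgebra ℝ C(ℕ → unitInterval, ℝ) := Algebra.adjoin ℝ (Set.range proj)
  have hA : A.SeparatesPoints := by
    intro y z hyz
    obtain ⟨i, hi⟩ := Function.ne_iff.1 hyz
    exact ⟨proj i, ⟨proj i, Algebra.subset_adjoin ⟨i, rfl⟩, rfl⟩, fun h => hi (Subtype.ext h)⟩
  -- Products of exponentials add the exponents, so each monomial is one Laplace function; the
  -- algebra is the linear span of these.
  have hmon : ∀ p ∈ Submonoid.closure (Set.range proj), ∃ g : C_c(E, ℝ≥0),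
      (∃ K : ℝ≥0, LipschitzWith K g) ∧ ∀ ξ, p (toCube h ξ) = Real.exp (-ξ.eval g) := by
    intro p hp
    induction hp using Submonoid.closure_induction with
    | mem p hp =>
      obtain ⟨i, rfl⟩ := hp
      exact ⟨h i, hL i, fun ξ => rfl⟩
    | one => exact ⟨0, exists_lipschitzWith_zero, fun ξ => by simp [eval_zero]⟩
    | mul p q _ _ hp hq =>
      obtain ⟨g₁, hg₁, h₁⟩ := hp
      obtain ⟨g₂, hg₂, h₂⟩ := hq
      refine ⟨g₁ + g₂, exists_lipschitzWith_add hg₁ hg₂, fun ξ => ?_⟩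
      rw [ContinuousMap.mul_apply, h₁, h₂, eval_add, neg_add, Real.exp_add]
  refine FiniteMeasure.tendsto_of_subalgebra_of_isInducing hΨ hA fun p hp => ?_
  have hint : ∀ (ν : FiniteMeasure (PointMeasure E)) (p : C(ℕ → unitInterval, ℝ)),
      Integrable (fun ξ => p (toCube h ξ)) (ν : Measure (PointMeasure E)) := fun ν p =>
    ((BoundedContinuousFunction.mkOfCompact p).compContinuous ⟨_, hΨ.continuous⟩).integrable _
  have hp' : p ∈ Submodule.span ℝ (Submonoid.closure (Set.range proj) : Set _) := by
    rw [← Algebra.adjoin_eq_span]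
    exact hp
  clear hp
  induction hp' using Submodule.span_induction with
  | mem p hp =>
    obtain ⟨g, hg, hpg⟩ := hmon p hp
    simpa only [hpg] using H g hg
  | zero => simp
  | add p q _ _ hp hq =>
    simp only [ContinuousMap.add_apply]
    simpa only [integral_add (hint _ p) (hint _ q)] using hp.add hq
  | smul c p _ hp =>
    simp only [ContinuousMap.smul_apply, smul_eq_mul, integral_const_mul]
    exact hp.const_mul c

/-- The sets `{ξ | ξ(h) < δ}` with `h` Lipschitz are a neighbourhood basis of the null measure. -/
theorem exists_lipschitz_setOf_eval_lt_subset {U : Set (PointMeasure E)}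
    (hU : U ∈ 𝓝 (0 : PointMeasure E)) :
    ∃ h : C_c(E, ℝ≥0), (∃ K : ℝ≥0, LipschitzWith K h) ∧ ∃ δ > 0, {ξ | ξ.eval h < δ} ⊆ U := by
  -- The sets with the desired property form a filter, so `l ≤ 𝓝 0` need only be checked on each
  -- evaluation generating the topology.
  let l : Filter (PointMeasure E) :=
    { sets := {U | ∃ h : C_c(E, ℝ≥0), (∃ K : ℝ≥0, LipschitzWith K h) ∧
        ∃ δ > 0, {ξ : PointMeasure E | ξ.eval h < δ} ⊆ U}
      univ_sets := ⟨0, exists_lipschitzWith_zero, 1, one_pos, Set.subset_univ _⟩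
      sets_of_superset := fun ⟨h, hh, δ, hδ, hs⟩ hst => ⟨h, hh, δ, hδ, hs.trans hst⟩
      inter_sets := by
        rintro s t ⟨h, hh, δ, hδ, hs⟩ ⟨h', hh', δ', hδ', ht⟩
        refine ⟨h + h', exists_lipschitzWith_add hh hh', min δ δ', lt_min hδ hδ', fun ξ hξ => ?_⟩
        have h0 := ξ.eval_nonneg h
        have h0' := ξ.eval_nonneg h'
        simp only [Set.mem_ofPred_eq, eval_add, lt_min_iff] at hξ
        exact ⟨hs ((le_add_of_nonneg_right h0').trans_lt hξ.1),
          ht ((le_add_of_nonneg_left h0).trans_lt hξ.2)⟩ }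
  have hl : l ≤ 𝓝 0 := by
    rw [nhds_eq_iInf_comap_eval]
    refine le_iInf fun g => ?_
    rw [← tendsto_iff_comap, zero_eval, Metric.tendsto_nhds]
    intro ε hε
    obtain ⟨χ, hχL, hχ⟩ := g.hasCompactSupport.isCompact.exists_lipschitz_bump
    obtain ⟨M, hM⟩ := (g.hasCompactSupport.isCompact_range g.continuous).bddAbove
    refine ⟨M • χ, exists_lipschitzWith_smul M hχL, ε, hε, fun ξ hξ => ?_⟩
    have hle : ξ.eval g ≤ ξ.eval (M • χ) := ξ.eval_mono fun x => by
      by_cases hx : x ∈ tsupport g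
      · simpa [hχ x hx] using hM ⟨x, rfl⟩
      · simp [image_eq_zero_of_notMem_tsupport hx]
    simp only [Set.mem_ofPred_eq, Real.dist_eq, sub_zero, abs_of_nonneg (ξ.eval_nonneg g)]
    exact hle.trans_lt hξ
  exact hl hU

end PointMeasure

/-! ### The cut-off functions -/

namespace PointMeasure

section Cutoff

variable {E : Type*} [TopologicalSpace E] [MeasurableSpace E]

/-- The function `1 - e^{-(ξ(g)-ε)_+}`. -/
noncomputable def cutoff (g : C_c(E, ℝ≥0)) (ε : ℝ) (ξ : PointMeasure E) : ℝ :=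
  1 - Real.exp (-(max (ξ.eval g - ε) 0))

theorem testF_eq (g₁ g₂ : C_c(E, ℝ≥0)) (ε₁ ε₂ : ℝ) (ξ : PointMeasure E) :
    testF g₁ g₂ ε₁ ε₂ ξ = cutoff g₁ ε₁ ξ * cutoff g₂ ε₂ ξ := rfl

theorem continuous_cutoff (g : C_c(E, ℝ≥0)) (ε : ℝ) : Continuous (cutoff g ε) :=
  continuous_const.sub (Real.continuous_exp.comp
    (((continuous_eval g).sub continuous_const).max continuous_const).neg)

theorem cutoff_nonneg (g : C_c(E, ℝ≥0)) (ε : ℝ) (ξ : PointMeasure E) : 0 ≤ cutoff g ε ξ :=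
  sub_nonneg.2 (Real.exp_le_one_iff.2 (neg_nonpos.2 (le_max_right _ _)))

theorem cutoff_le_one (g : C_c(E, ℝ≥0)) (ε : ℝ) (ξ : PointMeasure E) : cutoff g ε ξ ≤ 1 :=
  sub_le_self _ (Real.exp_pos _).le

theorem abs_cutoff_le_one (g : C_c(E, ℝ≥0)) (ε : ℝ) (ξ : PointMeasure E) :
    |cutoff g ε ξ| ≤ 1 := by
  rw [abs_of_nonneg (cutoff_nonneg g ε ξ)]
  exact cutoff_le_one g ε ξ

theorem cutoff_eq_zero {g : C_c(E, ℝ≥0)} {ε : ℝ} {ξ : PointMeasure E} (h : ξ.eval g ≤ ε) :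
    cutoff g ε ξ = 0 := by
  simp [cutoff, max_eq_right (sub_nonpos.2 h)]

theorem le_cutoff {g : C_c(E, ℝ≥0)} {ε δ : ℝ} {ξ : PointMeasure E} (h : δ ≤ ξ.eval g) :
    1 - Real.exp (-(δ - ε)) ≤ cutoff g ε ξ := by
  refine sub_le_sub_left (Real.exp_le_exp.2 (neg_le_neg ?_)) _
  exact (sub_le_sub_right h ε).trans (le_max_left _ _)

/-- `e^{-x}` is 1-Lipschitz on `[0, ∞)`, and `(x - ε)_+` is within `ε` of `x ≥ 0`. -/
theorem abs_exp_sub_one_sub_cutoff_le (g : C_c(E, ℝ≥0)) {ε : ℝ} (hε : 0 ≤ ε)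
    (ξ : PointMeasure E) : |Real.exp (-ξ.eval g) - (1 - cutoff g ε ξ)| ≤ ε := by
  have hx := ξ.eval_nonneg g
  simp only [cutoff, sub_sub_cancel]
  set x := ξ.eval g
  set y := max (x - ε) 0 with hy
  have hyx : y ≤ x := max_le (by linarith) hx
  have hxy : x - y ≤ ε := by linarith [le_max_left (x - ε) 0]
  have h1 : Real.exp (-x) = Real.exp (-y) * Real.exp (-(x - y)) := by
    rw [← Real.exp_add]; congr 1; ring
  have h2 : Real.exp (-y) ≤ 1 := Real.exp_le_one_iff.2 (neg_nonpos.2 (le_max_right _ _))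
  have h3 : Real.exp (-(x - y)) ≤ 1 := Real.exp_le_one_iff.2 (by linarith)
  have h4 := Real.one_sub_le_exp_neg (x - y)
  have h5 := Real.exp_pos (-y)
  rw [h1, abs_le]
  constructor <;> nlinarith

theorem continuous_testF (g₁ g₂ : C_c(E, ℝ≥0)) (ε₁ ε₂ : ℝ) : Continuous (testF g₁ g₂ ε₁ ε₂) :=
  (continuous_cutoff g₁ ε₁).mul (continuous_cutoff g₂ ε₂)

theorem eventually_cutoff_eq_zero (g : C_c(E, ℝ≥0)) {ε : ℝ} (hε : 0 < ε) :
    ∀ᶠ ξ in 𝓝 (0 : PointMeasure E), cutoff g ε ξ = 0 := by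
  have h : ∀ᶠ ξ in 𝓝 (0 : PointMeasure E), ξ.eval g < ε :=
    (continuous_eval g).continuousAt.eventually_lt continuousAt_const (by simpa [zero_eval] using hε)
  exact h.mono fun ξ hξ => cutoff_eq_zero hξ.le

/-- This recovers total masses from cut-offs. The factor gives `ξ(k • h) ≥ 1 + |log η|`; after
subtracting the threshold 1, the exponential is at most `e^{-|log η|} ≤ η`. -/
theorem exists_smul_cutoff_approx_one (h : C_c(E, ℝ≥0)) {ε η : ℝ} (hε : 0 < ε) (hη : 0 < η) :
    ∃ k : ℝ≥0, ∀ ξ : PointMeasure E, ε < ξ.eval h → |1 - cutoff (k • h) 1 ξ| ≤ η := by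
  refine ⟨((1 + |Real.log η|) / ε).toNNReal, fun ξ hξ => ?_⟩
  have hk : 1 + |Real.log η| ≤ ξ.eval (((1 + |Real.log η|) / ε).toNNReal • h) := by
    rw [eval_smul, Real.coe_toNNReal _ (by positivity)]
    calc 1 + |Real.log η| = (1 + |Real.log η|) / ε * ε := by field_simp
      _ ≤ _ := by gcongr
  have h1 := le_cutoff (ε := 1) hk
  rw [abs_of_nonneg (sub_nonneg.2 (cutoff_le_one _ _ _))]
  have h2 : Real.exp (-(1 + |Real.log η| - 1)) ≤ η := by
    rw [← Real.le_log_iff_exp_le hη]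
    linarith [neg_abs_le (Real.log η)]
  linarith

end Cutoff

end PointMeasure

/-! ### Weighted measures and the theorem -/

namespace MZero

open PointMeasure

section Weighted

variable {E : Type*} [TopologicalSpace E] [MeasurableSpace E]

/-- The cut-off is at most the indicator of `{ξ | ε ≤ ξ.eval h}`, the complement of a neighbourhood
of the null measure. -/
theorem lintegral_cutoff_lt_top (m : MZero E) (h : C_c(E, ℝ≥0)) {ε : ℝ} (hε : 0 < ε) :
    ∫⁻ ξ, ENNReal.ofReal (cutoff h ε ξ) ∂m.toMeasure < ∞ := by
  have hopen : IsOpen {ξ : PointMeasure E | ξ.eval h < ε} :=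
    isOpen_lt (continuous_eval h) continuous_const
  have hU : {ξ : PointMeasure E | ξ.eval h < ε} ∈ 𝓝 0 :=
    hopen.mem_nhds (by simpa [zero_eval] using hε)
  refine lt_of_le_of_lt ?_ (m.lt_top_compl _ hU)
  rw [← lintegral_indicator_one hopen.measurableSet.compl]
  refine lintegral_mono fun ξ => ?_
  by_cases hξ : ξ.eval h < ε
  · simp [cutoff_eq_zero hξ.le]
  · simpa [Set.indicator, hξ] using cutoff_le_one h ε ξ

/-- The finite measure with density `1 - e^{-(ξ(h)-ε)_+}` with respect to `m`. -/
noncomputable def weighted (m : MZero E) (h : C_c(E, ℝ≥0)) {ε : ℝ} (hε : 0 < ε) :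
    FiniteMeasure (PointMeasure E) :=
  ⟨m.toMeasure.withDensity fun ξ => ENNReal.ofReal (cutoff h ε ξ),
    isFiniteMeasure_withDensity (m.lintegral_cutoff_lt_top h hε).ne⟩

theorem integral_weighted (m : MZero E) (h : C_c(E, ℝ≥0)) {ε : ℝ} (hε : 0 < ε)
    (p : PointMeasure E → ℝ) :
    ∫ ξ, p ξ ∂(m.weighted h hε : Measure (PointMeasure E)) =
      ∫ ξ, cutoff h ε ξ * p ξ ∂m.toMeasure := by
  refine (integral_withDensity_eq_integral_toReal_smul
    (continuous_cutoff h ε).measurable.ennreal_ofReal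
    (.of_forall fun ξ => ENNReal.ofReal_lt_top) p).trans ?_
  simp only [ENNReal.toReal_ofReal (cutoff_nonneg h ε _), smul_eq_mul]

theorem ae_weighted_lt_eval (m : MZero E) (h : C_c(E, ℝ≥0)) {ε : ℝ} (hε : 0 < ε) :
    ∀ᵐ ξ ∂(m.weighted h hε : Measure (PointMeasure E)), ε < ξ.eval h := by
  refine (ae_withDensity_iff (continuous_cutoff h ε).measurable.ennreal_ofReal).2
    (.of_forall fun ξ hξ => ?_)
  by_contra hcon
  exact hξ (by simp [cutoff_eq_zero (not_lt.1 hcon)])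

end Weighted

section Convergence

variable {E : Type*} [MetricSpace E] [MeasurableSpace E]

/-- Convergence of the weighted measures on the functions `1 - e^{-(ξ(g)-ε)_+}` gives convergence
of their Laplace functionals. -/
theorem tendsto_laplace_weighted {mn : ℕ → MZero E} {m : MZero E} {h : C_c(E, ℝ≥0)}
    (hL : ∃ K : ℝ≥0, LipschitzWith K h) {ε : ℝ} (hε : 0 < ε)
    (H : ∀ (g : C_c(E, ℝ≥0)) (e : ℝ), (∃ K : ℝ≥0, LipschitzWith K g) → 0 < e →
      Tendsto (fun n => ∫ ξ, cutoff g e ξ ∂((mn n).weighted h hε : Measure (PointMeasure E))) atTop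
        (𝓝 (∫ ξ, cutoff g e ξ ∂(m.weighted h hε : Measure (PointMeasure E)))))
    (g : C_c(E, ℝ≥0)) (hg : ∃ K : ℝ≥0, LipschitzWith K g) :
    Tendsto (fun n => ∫ ξ, Real.exp (-ξ.eval g)
        ∂((mn n).weighted h hε : Measure (PointMeasure E))) atTop
      (𝓝 (∫ ξ, Real.exp (-ξ.eval g) ∂(m.weighted h hε : Measure (PointMeasure E)))) := by
  have hcut : ∀ (ν : FiniteMeasure (PointMeasure E)) (g : C_c(E, ℝ≥0)) (e : ℝ),
      Integrable (cutoff g e) (ν : Measure (PointMeasure E)) := fun ν g e =>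
    .of_bound (continuous_cutoff g e).aestronglyMeasurable 1
      (.of_forall fun ξ => abs_cutoff_le_one g e ξ)
  have hlap : ∀ ν : FiniteMeasure (PointMeasure E),
      Integrable (fun ξ => Real.exp (-ξ.eval g)) (ν : Measure (PointMeasure E)) := fun ν =>
    .of_bound (Real.continuous_exp.comp (continuous_eval g).neg).aestronglyMeasurable 1
      (.of_forall fun ξ => by
        rw [Real.norm_of_nonneg (Real.exp_pos _).le]
        exact Real.exp_le_one_iff.2 (neg_nonpos.2 (ξ.eval_nonneg g)))
  obtain ⟨M, hM⟩ : ∃ M : ℝ, ∀ n,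
      ((mn n).weighted h hε : Measure (PointMeasure E)).real Set.univ ≤ M := by
    -- Almost everywhere `1 ≤ 2 * cutoff (k • h) 1`, and the integrals of the latter converge, hence
    -- are bounded.
    obtain ⟨k, hk⟩ := exists_smul_cutoff_approx_one h hε (one_half_pos (α := ℝ))
    obtain ⟨B, hB⟩ := (H (k • h) 1 (exists_lipschitzWith_smul k hL) one_pos).bddAbove_range
    refine ⟨2 * B, fun n => ?_⟩
    calc ((mn n).weighted h hε : Measure (PointMeasure E)).real Set.univ
        = ∫ _, (1 : ℝ) ∂((mn n).weighted h hε : Measure (PointMeasure E)) := by simp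
      _ ≤ ∫ ξ, 2 * cutoff (k • h) 1 ξ ∂((mn n).weighted h hε : Measure (PointMeasure E)) := by
        refine integral_mono_ae (integrable_const _) ((hcut _ _ _).const_mul 2) ?_
        filter_upwards [(mn n).ae_weighted_lt_eval h hε] with ξ hξ
        have := (abs_le.1 (hk ξ hξ)).2
        linarith
      _ ≤ 2 * B := by
        rw [integral_const_mul]
        exact mul_le_mul_of_nonneg_left (hB ⟨n, rfl⟩) zero_le_two
  have hmass : Tendsto
      (fun n => ∫ _, (1 : ℝ) ∂((mn n).weighted h hε : Measure (PointMeasure E))) atTop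
      (𝓝 (∫ _, (1 : ℝ) ∂(m.weighted h hε : Measure (PointMeasure E)))) := by
    refine tendsto_integral_of_approx hM (fun n => integrable_const _) (integrable_const _)
      fun η hη => ?_
    obtain ⟨k, hk⟩ := exists_smul_cutoff_approx_one h hε hη
    exact ⟨_, fun n => hcut _ _ _, hcut _ _ _, fun n => ((mn n).ae_weighted_lt_eval h hε).mono hk,
      (m.ae_weighted_lt_eval h hε).mono hk, H (k • h) 1 (exists_lipschitzWith_smul k hL) one_pos⟩
  refine tendsto_integral_of_approx hM (fun n => hlap _) (hlap _) fun η hη => ?_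
  refine ⟨fun ξ => 1 - cutoff g η ξ, fun n => (integrable_const _).sub (hcut _ _ _),
    (integrable_const _).sub (hcut _ _ _),
    fun n => .of_forall (abs_exp_sub_one_sub_cutoff_le g hη.le),
    .of_forall (abs_exp_sub_one_sub_cutoff_le g hη.le), ?_⟩
  have hsub : ∀ ν : FiniteMeasure (PointMeasure E),
      ∫ ξ, (1 - cutoff g η ξ) ∂(ν : Measure (PointMeasure E)) =
        ∫ _, (1 : ℝ) ∂(ν : Measure (PointMeasure E)) -
          ∫ ξ, cutoff g η ξ ∂(ν : Measure (PointMeasure E)) := fun ν =>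
    integral_sub (integrable_const _) (hcut ν g η)
  simp only [hsub]
  exact hmass.sub (H g η hg hη)

theorem converges_of_tendsto_lipschitz [BorelSpace E]
    [TopologicalSpace.SeparableSpace E] [LocallyCompactSpace E]
    {mn : ℕ → MZero E} {m : MZero E}
    (H : ∀ (g₁ g₂ : C_c(E, ℝ≥0)) (ε₁ ε₂ : ℝ),
      (∃ K : ℝ≥0, LipschitzWith K g₁) → (∃ K : ℝ≥0, LipschitzWith K g₂) → 0 < ε₁ → 0 < ε₂ →
      Tendsto (fun n => ∫ ξ, testF g₁ g₂ ε₁ ε₂ ξ ∂(mn n).toMeasure) atTop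
        (𝓝 (∫ ξ, testF g₁ g₂ ε₁ ε₂ ξ ∂m.toMeasure))) :
    Converges mn m := by
  intro f hf
  obtain ⟨h, hL, δ, hδ, hf0⟩ := exists_lipschitz_setOf_eval_lt_subset hf
  -- A threshold below `δ` keeps the weight at least `c > 0` on `{ξ | δ ≤ ξ.eval h}`, off which `f`
  -- vanishes.
  have hε : 0 < δ / 2 := half_pos hδ
  have hweak : Tendsto (fun n => (mn n).weighted h hε) atTop (𝓝 (m.weighted h hε)) := by
    refine tendsto_of_tendsto_laplace fun g hg => tendsto_laplace_weighted hL hε ?_ g hg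
    intro g e hg he
    simp only [integral_weighted]
    exact H h g (δ / 2) e hL hg hε he
  set c : ℝ := 1 - Real.exp (-(δ - δ / 2)) with hc
  have hc0 : 0 < c := sub_pos.2 (Real.exp_lt_one_iff.2 (by linarith))
  have hpos : ∀ ξ : PointMeasure E, 0 < max (cutoff h (δ / 2) ξ) c := fun ξ =>
    lt_max_of_lt_right hc0
  -- The maximum with `c` keeps the quotient continuous and bounded everywhere, and changes nothing
  -- where `f ≠ 0`.
  have hcont : Continuous fun ξ : PointMeasure E => f ξ / max (cutoff h (δ / 2) ξ) c :=
    f.continuous.div ((continuous_cutoff h _).max continuous_const) fun ξ => (hpos ξ).ne'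
  let F : PointMeasure E →ᵇ ℝ := BoundedContinuousFunction.ofNormedAddCommGroup _ hcont (‖f‖ / c)
    fun ξ => by
      rw [norm_div, Real.norm_of_nonneg (hpos ξ).le]
      exact div_le_div₀ (norm_nonneg _) (f.norm_coe_le_norm ξ) hc0 (le_max_right _ _)
  have hfF : ∀ ξ, cutoff h (δ / 2) ξ * F ξ = f ξ := by
    intro ξ
    change _ * (f ξ / max (cutoff h (δ / 2) ξ) c) = _
    rcases lt_or_ge (ξ.eval h) δ with hξ | hξ
    · have : f ξ = 0 := hf0 hξ
      simp [this]
    · have hle : c ≤ cutoff h (δ / 2) ξ := le_cutoff hξ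
      rw [max_eq_left hle, mul_div_cancel₀ _ (hc0.trans_le hle).ne']
  have := FiniteMeasure.tendsto_iff_forall_integral_tendsto.1 hweak F
  simpa only [integral_weighted, hfF] using this

end Convergence

theorem Converges.tendsto_integral_testF {E : Type*} [TopologicalSpace E] [MeasurableSpace E]
    {mn : ℕ → MZero E} {m : MZero E} (H : Converges mn m)
    (g₁ g₂ : C_c(E, ℝ≥0)) {ε₁ : ℝ} (ε₂ : ℝ) (hε₁ : 0 < ε₁) :
    Tendsto (fun n => ∫ ξ, testF g₁ g₂ ε₁ ε₂ ξ ∂(mn n).toMeasure) atTop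
      (𝓝 (∫ ξ, testF g₁ g₂ ε₁ ε₂ ξ ∂m.toMeasure)) := by
  refine H (BoundedContinuousFunction.ofNormedAddCommGroup (testF g₁ g₂ ε₁ ε₂)
    (continuous_testF g₁ g₂ ε₁ ε₂) 1 fun ξ => ?_) ?_
  · rw [testF_eq, Real.norm_eq_abs, abs_mul]
    exact mul_le_one₀ (abs_cutoff_le_one _ _ _) (abs_nonneg _) (abs_cutoff_le_one _ _ _)
  · filter_upwards [eventually_cutoff_eq_zero g₁ hε₁] with ξ hξ
    exact (testF_eq g₁ g₂ ε₁ ε₂ ξ).trans (by rw [hξ, zero_mul])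

end MZero

theorem theoremA3 {E : Type*} [MetricSpace E] [CompleteSpace E]
    [TopologicalSpace.SeparableSpace E] [LocallyCompactSpace E] [MeasurableSpace E] [BorelSpace E]
    (mn : ℕ → MZero E) (m : MZero E) :
    (MZero.Converges mn m ↔
      ∀ (g₁ g₂ : C_c(E, ℝ≥0)) (ε₁ ε₂ : ℝ), 0 < ε₁ → 0 < ε₂ →
        Tendsto (fun n => ∫ ξ, PointMeasure.testF g₁ g₂ ε₁ ε₂ ξ ∂(mn n).toMeasure) atTop
          (𝓝 (∫ ξ, PointMeasure.testF g₁ g₂ ε₁ ε₂ ξ ∂m.toMeasure))) ∧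
    ((∀ (g₁ g₂ : C_c(E, ℝ≥0)) (ε₁ ε₂ : ℝ),
        (∃ K : ℝ≥0, LipschitzWith K g₁) → (∃ K : ℝ≥0, LipschitzWith K g₂) → 0 < ε₁ → 0 < ε₂ →
        Tendsto (fun n => ∫ ξ, PointMeasure.testF g₁ g₂ ε₁ ε₂ ξ ∂(mn n).toMeasure) atTop
          (𝓝 (∫ ξ, PointMeasure.testF g₁ g₂ ε₁ ε₂ ξ ∂m.toMeasure))) →
      MZero.Converges mn m) :=
  ⟨⟨fun H g₁ g₂ _ ε₂ h₁ _ => H.tendsto_integral_testF g₁ g₂ ε₂ h₁,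
    fun H => MZero.converges_of_tendsto_lipschitz fun g₁ g₂ ε₁ ε₂ _ _ => H g₁ g₂ ε₁ ε₂⟩,
    MZero.converges_of_tendsto_lipschitz⟩
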